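/- Fix constants $0<\beta\le 1$ and $0<\alpha<\tfrac12$. For each $N$ consider a system of $N$ servers, each with its own first-come-first-served queue of unlimited size. Jobs arrive according to a Poisson process of rate $N\lambda/k$ with load $\lambda=1-\beta N^{-\alpha}$; each job consists of $k$ tasks whose service times are independent and exponential with rate $1$. Tasks are assigned by batch-filling with probe overhead $d>0$ (where $kd$ is an integer): an arriving job samples $kd$ of the $N$ queues uniformly at random without replacement, and its $k$ tasks are put one by one into a currently shortest sampled queue, the queue lengths being updated after each task. Let $S_i$ be the fraction of servers having at least $i$ tasks (including the one in service). Here $k=k(N)$, $d=d(N)$ and the nonnegative integer $h=h(N)$ may depend on $N$, and all asymptotics are for $N\to\infty$. Assume $$k=\omega(1),\qquad k=e^{o(\sqrt{\log N})},\qquad d=e^{o(\log N/\log k)},\qquad h=O(\log k).$$ Then for all sufficiently large $N$ the continuous-time Markov chain $(S_0(t),S_1(t),S_2(t),\dots)$ has a unique stationary distribution, and if $(S_i)_{i\ge 0}$ is distributed according to it, then $$\Pr\Big\{\sum_{i=1}^{h}S_i\ \ge\ h-\frac{1}{3d}\Big\}\ \ge\ \frac{1}{4e^2}.$$ -/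

import Mathlib

open Filter Asymptotics Topology

namespace BatchFilling

noncomputable section

/-- A state of the system with `N` queues (unlimited buffers): the multiset of the `N` queue
lengths, a queue length counting the task in service.  The multiplicity of `i` in the state is
`N * (S_i - S_{i+1})`, so a state carries the same information as the sequence
`(S_0, S_1, S_2, ...)` of the fractions of servers with at least `i` tasks. -/
abbrev State (N : ℕ) : Type := Sym ℕ N

/-- `frac s i` is `S_i`: the fraction of the servers that have at least `i` tasks. -/
def frac {N : ℕ} (s : State N) (i : ℕ) : ℝ :=
  ((s : Multiset ℕ).countP (fun x => i ≤ x) : ℝ) / N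

/-- One round of batch-filling on a multiset `a` of sampled queue lengths: one task is put into a
shortest sampled queue, whose length goes up by one (nothing happens if there is no queue). -/
def assignOne (a : Multiset ℕ) : Multiset ℕ :=
  if a = 0 then 0 else (sInf {x | x ∈ a} + 1) ::ₘ a.erase (sInf {x | x ∈ a})

/-- Batch-filling of the `k` tasks of a job: `k` rounds, with the queue lengths updated after
each of them. -/
def fill (k : ℕ) (a : Multiset ℕ) : Multiset ℕ := assignOne^[k] a

/-- Rate of the transitions from `s` to `s'` that are caused by a job arrival.  Jobs of `k` tasks
arrive at rate `N * lam / k`; a job samples `m` of the `N` queues uniformly at random without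
replacement.  (`Multiset.powersetCard m s` lists, with multiplicity, the queue lengths in each of
the `N.choose m` possible samples.) -/
def arrivalRate {N : ℕ} (lam : ℝ) (k m : ℕ) (s s' : State N) : ℝ :=
  (N * lam / k) *
    (((Multiset.powersetCard m (s : Multiset ℕ)).countP
      (fun a => (s : Multiset ℕ) - a + fill k a = (s' : Multiset ℕ)) : ℝ) / (N.choose m : ℝ))

/-- Rate of the transitions from `s` to `s'` that are caused by a task completion: every nonempty
queue completes tasks at rate `1`, and then its length goes down by one. -/
def departureRate {N : ℕ} (s s' : State N) : ℝ :=
  ((s : Multiset ℕ).countP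
    (fun x => 0 < x ∧ (x - 1) ::ₘ (s : Multiset ℕ).erase x = (s' : Multiset ℕ)) : ℝ)

/-- Transition rates of the continuous-time Markov chain of the system with `N` servers, load
`lam`, `k` tasks per job and `m` probes per job, under batch-filling. -/
def rate {N : ℕ} (lam : ℝ) (k m : ℕ) (s s' : State N) : ℝ :=
  arrivalRate lam k m s s' + departureRate s s'

/-- `π` is a stationary distribution of the chain: at every state the probability flow in equals
the probability flow out.  The total rate out of a state is at most `N * lam / k + N`, so these
global balance equations characterize invariance under the transition semigroup. -/
def IsStationary {N : ℕ} (lam : ℝ) (k m : ℕ) (π : PMF (State N)) : Prop :=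
  ∀ s' : State N,
    ∑' s : State N, π s * ENNReal.ofReal (rate lam k m s s') =
      π s' * ∑' s : State N, ENNReal.ofReal (rate lam k m s' s)

end

end BatchFilling

/-!
A stationary law conserves the flow of tasks, so in the mean at most a fraction `1 - lam` of the
servers is idle. Let `E i` be the mean number of queues shorter than `i` and `d = m / k`. A queue of
length `i` becomes shorter than `i` at rate `1`, whereas a queue is sampled at rate `lam * d`, so
balancing the number of queues shorter than `i` gives `E (i + 1) ≤ (1 + lam * d) * E i`. Summing the
geometric series, the mean of `h - ∑ i ∈ Finset.Icc 1 h, S_i` is at most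
`(1 - lam) * (1 + d) ^ h / d`. As `(1 + d) ^ h = N ^ o(1)` while `1 - lam = β * N ^ (-α)`, this is
`o(1 / d)`, and Markov's inequality applies.

The sum of the squared queue lengths is a Lyapunov function, which yields a stationary law as a
limit of Cesàro averages of the uniformized jump chain. If `μ` and `ν` are two stationary laws, then
the positive parts of `μ - ν` and `ν - μ` are balanced. If `μ ≠ ν`, both would charge the empty
system, which is reachable from everywhere, although their supports are disjoint.
-/

namespace MarkovJump

open scoped ENNReal

variable {X : Type*}

/-- The expectation of `f` under the probability law `μ`. -/
noncomputable def mean (μ : PMF X) (f : X → ℝ≥0∞) : ℝ≥0∞ := ∑' x, μ x * f x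

theorem mean_mono (μ : PMF X) {f g : X → ℝ≥0∞} (h : ∀ x, f x ≤ g x) : mean μ f ≤ mean μ g :=
  ENNReal.tsum_le_tsum fun x => mul_le_mul_right (h x) (μ x)

theorem mean_add (μ : PMF X) (f g : X → ℝ≥0∞) :
    mean μ (fun x => f x + g x) = mean μ f + mean μ g := by
  simp only [mean, mul_add, ENNReal.tsum_add]

theorem mean_const (μ : PMF X) (c : ℝ≥0∞) : mean μ (fun _ => c) = c := by
  rw [mean, ENNReal.tsum_mul_right, μ.tsum_coe, one_mul]

theorem mean_const_mul (μ : PMF X) (c : ℝ≥0∞) (f : X → ℝ≥0∞) :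
    mean μ (fun x => c * f x) = c * mean μ f := by
  simp only [mean, ← ENNReal.tsum_mul_left, mul_left_comm]

theorem mean_finsetSum {ι : Type*} (μ : PMF X) (F : Finset ι) (f : ι → X → ℝ≥0∞) :
    mean μ (fun x => ∑ i ∈ F, f i x) = ∑ i ∈ F, mean μ (f i) := by
  simp only [mean, Finset.mul_sum]
  exact Summable.tsum_finsetSum fun _ _ => ENNReal.summable

theorem mean_bind {Y : Type*} (μ : PMF X) (P : X → PMF Y) (f : Y → ℝ≥0∞) :
    mean (μ.bind P) f = mean μ fun x => mean (P x) f := by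
  simp only [mean, PMF.bind_apply, ← ENNReal.tsum_mul_right, ← ENNReal.tsum_mul_left]
  rw [ENNReal.tsum_comm]
  simp only [mul_assoc]

theorem le_of_forall_mean_ite_le {μ : PMF X} (g : X → ℝ) {c B : ℝ≥0∞}
    (h : ∀ n : ℕ, mean μ (fun x => if g x ≤ n then c else 0) ≤ B) : c ≤ B := by
  rw [← mean_const μ c]
  refine ENNReal.summable.tsum_le_of_sum_le fun F => ?_
  obtain ⟨M, hM⟩ := (F.image g).exists_le
  obtain ⟨n, hn⟩ := exists_nat_ge M
  refine le_trans (Finset.sum_le_sum fun x hx => ?_) ((ENNReal.sum_le_tsum F).trans (h n))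
  beta_reduce
  rw [if_pos ((hM _ (Finset.mem_image_of_mem g hx)).trans hn)]

theorem natCast_le_mul_sum_add_mean (μ : PMF X) (W : X → ℝ≥0∞) (c : ℕ) {F : Finset X}
    (hF : ∀ x ∉ F, c ≤ W x) : (c : ℝ≥0∞) ≤ c * ∑ x ∈ F, μ x + mean μ W := by
  classical
  calc (c : ℝ≥0∞) = mean μ (fun _ => c) := (mean_const μ _).symm
    _ ≤ mean μ (fun x => c * (if x ∈ F then 1 else 0) + W x) := by
      refine mean_mono μ fun x => ?_
      split_ifs with hx
      · simp
      · simpa using hF x hx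
    _ = c * ∑ x ∈ F, μ x + mean μ W := by
      rw [mean_add, mean_const_mul, mean, tsum_eq_sum (s := F) fun x hx => by simp [hx]]
      congr 2
      exact Finset.sum_congr rfl fun x hx => by simp [hx]

theorem one_le_toOuterMeasure_add_mean (μ : PMF X) (g : X → ℝ) {δ : ℝ} (hδ : 0 < δ) :
    1 ≤ μ.toOuterMeasure {x | g x ≤ δ} + mean μ (fun x => .ofReal (g x)) / .ofReal δ := by
  rw [PMF.toOuterMeasure_apply, mean, div_eq_mul_inv, ← ENNReal.tsum_mul_right,
    ← ENNReal.tsum_add, ← μ.tsum_coe]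
  refine ENNReal.tsum_le_tsum fun x => ?_
  by_cases hx : g x ≤ δ
  · rw [Set.indicator_of_mem (show x ∈ {x | g x ≤ δ} from hx)]
    exact le_self_add
  · rw [Set.indicator_of_notMem (show x ∉ {x | g x ≤ δ} from hx), zero_add, mul_assoc,
      ← div_eq_mul_inv]
    refine le_mul_of_one_le_right' ?_
    rw [ENNReal.le_div_iff_mul_le (.inl (ENNReal.ofReal_pos.2 hδ).ne') (.inl ENNReal.ofReal_ne_top),
      one_mul]
    exact ENNReal.ofReal_le_ofReal (not_le.1 hx).le

theorem pmf_eq_of_le {μ ν : PMF X} (h : ∀ x, μ x ≤ ν x) : μ = ν := by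
  refine PMF.ext fun x => (h x).eq_of_not_lt fun hx => ?_
  have hlt := ENNReal.tsum_lt_tsum μ.tsum_coe_ne_top h hx
  simp only [PMF.tsum_coe, lt_irrefl] at hlt

/-- The global balance equations of the jump rates `q`, for a weight `w` that need not have
mass one: the proof of uniqueness applies them to the positive part of a difference of laws. -/
def Balanced (q : X → X → ℝ≥0∞) (w : X → ℝ≥0∞) : Prop :=
  ∀ y, ∑' x, w x * q x y = w y * ∑' z, q y z

namespace Balanced

variable {q : X → X → ℝ≥0∞} {v w : X → ℝ≥0∞}

theorem mean_tsum_rate_mul {μ : PMF X} (h : Balanced q μ) (f : X → ℝ≥0∞) :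
    mean μ (fun x => ∑' y, q x y * f y) = mean μ fun x => (∑' y, q x y) * f x := by
  simp only [mean, ← ENNReal.tsum_mul_left]
  rw [ENNReal.tsum_comm]
  simp only [← mul_assoc, ENNReal.tsum_mul_right, h _]

theorem ne_zero_of_reflTransGen (h : Balanced q w) {x y : X}
    (hxy : Relation.ReflTransGen (fun x y => q x y ≠ 0) x y) (hx : w x ≠ 0) : w y ≠ 0 := by
  induction hxy with
  | refl => exact hx
  | @tail b c _ hbc ih =>
    intro hc
    have h0 := h c
    rw [hc, zero_mul, ENNReal.tsum_eq_zero] at h0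
    exact mul_ne_zero ih hbc (h0 b)

/-- The balance equations of `v` and `w` give one inequality for `v - w` at every state; summed
over all states its two sides agree, so none of the inequalities is strict. -/
theorem tsub (hv : Balanced q v) (hw : Balanced q w) (hv_fin : ∑' x, v x ≠ ∞) {L : ℝ≥0∞}
    (hL : L ≠ ∞) (hq : ∀ x, ∑' y, q x y ≤ L) : Balanced q (v - w) := by
  have hle : ∀ y, (v - w) y * ∑' z, q y z ≤ ∑' x, (v - w) x * q x y := by
    intro y
    rw [Pi.sub_apply, ENNReal.sub_mul fun _ _ => ne_top_of_le_ne_top hL (hq y),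
      tsub_le_iff_left, ← hv y, ← hw y, ← ENNReal.tsum_add]
    refine ENNReal.tsum_le_tsum fun x => ?_
    rw [← add_mul]
    gcongr
    exact le_add_tsub
  have hsum : ∑' y, ∑' x, (v - w) x * q x y = ∑' y, (v - w) y * ∑' z, q y z := by
    rw [ENNReal.tsum_comm]
    simp only [ENNReal.tsum_mul_left]
  have hfin : ∑' y, (v - w) y * ∑' z, q y z ≠ ∞ := by
    refine ne_top_of_le_ne_top (ENNReal.mul_ne_top hv_fin hL) ?_
    rw [← ENNReal.tsum_mul_right]
    exact ENNReal.tsum_le_tsum fun y => mul_le_mul' tsub_le_self (hq y)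
  exact fun y => ((hle y).eq_of_not_lt fun hlt =>
    (ENNReal.tsum_lt_tsum hfin hle hlt).ne hsum.symm).symm

theorem pmf_unique {μ ν : PMF X} (hμ : Balanced q μ) (hν : Balanced q ν) {L : ℝ≥0∞}
    (hL : L ≠ ∞) (hq : ∀ x, ∑' y, q x y ≤ L) (x₀ : X)
    (hreach : ∀ x, Relation.ReflTransGen (fun x y => q x y ≠ 0) x x₀) : μ = ν := by
  wlog h : μ x₀ ≤ ν x₀ generalizing μ ν
  · exact (this hν hμ (le_of_not_ge h)).symm
  refine pmf_eq_of_le fun x => ?_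
  by_contra hx
  exact (hμ.tsub hν μ.tsum_coe_ne_top hL hq).ne_zero_of_reflTransGen (hreach x)
    (fun h0 => hx (tsub_eq_zero_iff_le.1 h0)) (tsub_eq_zero_of_le h)

end Balanced

section KrylovBogoliubov

/-- The law after `n` steps of the chain with transition laws `P` started at `x₀`. -/
noncomputable def lawAt (P : X → PMF X) (x₀ : X) (n : ℕ) : PMF X :=
  (fun μ => μ.bind P)^[n] (PMF.pure x₀)

/-- The Cesàro average of the laws of the chain at the times `0, …, n`, that is, its law at a
uniformly random one of these times. -/
noncomputable def cesaroLaw (P : X → PMF X) (x₀ : X) (n : ℕ) : PMF X :=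
  (PMF.uniformOfFintype (Fin (n + 1))).bind fun j => lawAt P x₀ j

variable (P : X → PMF X) (x₀ : X)

theorem lawAt_succ (n : ℕ) : lawAt P x₀ (n + 1) = (lawAt P x₀ n).bind P :=
  Function.iterate_succ_apply' _ _ _

theorem mean_uniformOfFintype_fin (n : ℕ) (f : ℕ → ℝ≥0∞) :
    mean (PMF.uniformOfFintype (Fin (n + 1))) (fun j => f j) =
      (∑ j ∈ Finset.range (n + 1), f j) / (n + 1 : ℕ) := by
  simp only [mean, PMF.uniformOfFintype_apply, Fintype.card_fin, tsum_fintype,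
    ← Finset.mul_sum, Fin.sum_univ_eq_sum_range f, ENNReal.div_eq_inv_mul]

theorem mean_cesaroLaw (n : ℕ) (f : X → ℝ≥0∞) :
    mean (cesaroLaw P x₀ n) f =
      (∑ j ∈ Finset.range (n + 1), mean (lawAt P x₀ j) f) / (n + 1 : ℕ) := by
  rw [cesaroLaw, mean_bind, ← mean_uniformOfFintype_fin n fun j => mean (lawAt P x₀ j) f]

theorem cesaroLaw_apply (n : ℕ) (x : X) :
    cesaroLaw P x₀ n x = (∑ j ∈ Finset.range (n + 1), lawAt P x₀ j x) / (n + 1 : ℕ) := by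
  rw [cesaroLaw, PMF.bind_apply]
  exact mean_uniformOfFintype_fin n fun j => lawAt P x₀ j x

theorem bind_cesaroLaw_apply_add (n : ℕ) (x : X) :
    (cesaroLaw P x₀ n).bind P x + lawAt P x₀ 0 x / (n + 1 : ℕ) =
      cesaroLaw P x₀ n x + lawAt P x₀ (n + 1) x / (n + 1 : ℕ) := by
  have hbind : (cesaroLaw P x₀ n).bind P x =
      (∑ j ∈ Finset.range (n + 1), lawAt P x₀ (j + 1) x) / (n + 1 : ℕ) := by
    rw [PMF.bind_apply]
    simp only [lawAt_succ, PMF.bind_apply]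
    exact mean_cesaroLaw P x₀ n fun y => P y x
  rw [hbind, cesaroLaw_apply, ← ENNReal.add_div, ← ENNReal.add_div,
    ← Finset.sum_range_succ' (fun j => lawAt P x₀ j x), Finset.sum_range_succ]

variable {P} {V W : X → ℝ≥0∞} {C : ℝ≥0∞}

theorem mean_lawAt_add_sum_mean_lawAt_le (hdrift : ∀ x, mean (P x) V + W x ≤ V x + C) (n : ℕ) :
    mean (lawAt P x₀ n) V + ∑ j ∈ Finset.range n, mean (lawAt P x₀ j) W ≤ V x₀ + n * C := by
  induction n with
  | zero => simp [mean, lawAt, PMF.pure_apply, tsum_ite_eq]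
  | succ n ih =>
    have hstep : mean (lawAt P x₀ (n + 1)) V + mean (lawAt P x₀ n) W ≤
        mean (lawAt P x₀ n) V + C := by
      rw [lawAt_succ, mean_bind, ← mean_add]
      refine (mean_mono _ hdrift).trans_eq ?_
      rw [mean_add, mean_const]
    rw [Finset.sum_range_succ_comm, ← add_assoc]
    calc _ ≤ mean (lawAt P x₀ n) V + C + ∑ j ∈ Finset.range n, mean (lawAt P x₀ j) W := by gcongr
      _ = mean (lawAt P x₀ n) V + ∑ j ∈ Finset.range n, mean (lawAt P x₀ j) W + C := by ring
      _ ≤ V x₀ + n * C + C := by gcongr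
      _ = V x₀ + (n + 1 : ℕ) * C := by push_cast; ring

theorem mean_cesaroLaw_le (hdrift : ∀ x, mean (P x) V + W x ≤ V x + C) (n : ℕ) :
    mean (cesaroLaw P x₀ n) W ≤ V x₀ + C := by
  rw [mean_cesaroLaw]
  refine ENNReal.div_le_of_le_mul ?_
  refine (le_add_self.trans (mean_lawAt_add_sum_mean_lawAt_le x₀ hdrift (n + 1))).trans ?_
  rw [add_mul, mul_comm C]
  gcongr
  exact le_mul_of_one_le_right' (by exact_mod_cast Nat.le_add_left 1 n)

theorem one_le_of_forall_natCast_le_mul_add {p B : ℝ≥0∞} (hB : B ≠ ∞)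
    (h : ∀ c : ℕ, (c : ℝ≥0∞) ≤ c * p + B) : 1 ≤ p := by
  have hbound : Tendsto (fun c : ℕ => p + B * (c : ℝ≥0∞)⁻¹) atTop (𝓝 p) := by
    simpa using tendsto_const_nhds.add
      (ENNReal.Tendsto.const_mul ENNReal.tendsto_inv_nat_nhds_zero (Or.inr hB))
  refine ge_of_tendsto hbound ((eventually_gt_atTop 0).mono fun c hc => ?_)
  have hc0 : (c : ℝ≥0∞) ≠ 0 := by exact_mod_cast hc.ne'
  have hcc : (c : ℝ≥0∞) * (c : ℝ≥0∞)⁻¹ = 1 := ENNReal.mul_inv_cancel hc0 (ENNReal.natCast_ne_top c)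
  calc (1 : ℝ≥0∞) = c * (c : ℝ≥0∞)⁻¹ := hcc.symm
    _ ≤ (c * p + B) * (c : ℝ≥0∞)⁻¹ := by gcongr; exact h c
    _ = c * (c : ℝ≥0∞)⁻¹ * p + B * (c : ℝ≥0∞)⁻¹ := by ring
    _ = p + B * (c : ℝ≥0∞)⁻¹ := by rw [hcc, one_mul]

/-- A tight family does not lose mass in a pointwise limit; `W` witnesses the tightness. -/
theorem tsum_eq_one_of_tendsto {ι : Type*} {l : Filter ι} [l.NeBot] {A : ι → PMF X}
    {w : X → ℝ≥0∞} (hlim : ∀ x, Tendsto (fun i => A i x) l (𝓝 (w x)))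
    (hW : ∀ n : ℕ, {x | W x ≤ n}.Finite) {B : ℝ≥0∞} (hB : B ≠ ∞)
    (hAW : ∀ i, mean (A i) W ≤ B) : ∑' x, w x = 1 := by
  have hle : ∑' x, w x ≤ 1 := by
    refine ENNReal.summable.tsum_le_of_sum_le fun F => ?_
    refine le_of_tendsto (tendsto_finsetSum F fun x _ => hlim x) (Eventually.of_forall fun i => ?_)
    exact (ENNReal.sum_le_tsum F).trans (A i).tsum_coe.le
  have hmarkov : ∀ c : ℕ, (c : ℝ≥0∞) ≤ c * ∑' x, w x + B := by
    intro c
    have hout : ∀ x ∉ (hW c).toFinset, (c : ℝ≥0∞) ≤ W x := by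
      intro x hx
      rw [Set.Finite.mem_toFinset, Set.mem_ofPred_eq, not_le] at hx
      exact hx.le
    have hA : ∀ i, (c : ℝ≥0∞) ≤ c * ∑ x ∈ (hW c).toFinset, A i x + B := fun i =>
      (natCast_le_mul_sum_add_mean (A i) W c hout).trans (by gcongr; exact hAW i)
    refine (ge_of_tendsto ((ENNReal.Tendsto.const_mul (tendsto_finsetSum _ fun x _ => hlim x)
      (Or.inr (ENNReal.natCast_ne_top c))).add_const B) (Eventually.of_forall hA)).trans ?_
    gcongr
    exact ENNReal.sum_le_tsum _
  exact le_antisymm hle (one_le_of_forall_natCast_le_mul_add hB hmarkov)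

theorem tendsto_pmf_apply_div_atTop_zero (μ : ℕ → PMF X) (x : X) :
    Tendsto (fun n => μ n x / (n + 1 : ℕ)) atTop (𝓝 0) := by
  have hinv : Tendsto (fun n : ℕ => ((n + 1 : ℕ) : ℝ≥0∞)⁻¹) atTop (𝓝 0) :=
    ENNReal.tendsto_inv_nat_nhds_zero.comp (tendsto_add_atTop_nat 1)
  refine tendsto_of_tendsto_of_tendsto_of_le_of_le tendsto_const_nhds hinv
    (fun n => bot_le) fun n => ?_
  rw [div_eq_mul_inv]
  exact mul_le_of_le_one_left' ((μ n).coe_le_one x)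

theorem exists_bind_eq_of_drift (hpred : ∀ y, {x | P x y ≠ 0}.Finite) (hV : V x₀ ≠ ∞)
    (hC : C ≠ ∞) (hW : ∀ n : ℕ, {x | W x ≤ n}.Finite)
    (hdrift : ∀ x, mean (P x) V + W x ≤ V x + C) : ∃ μ : PMF X, μ.bind P = μ := by
  let l : Ultrafilter ℕ := hyperfilter ℕ
  have hl : (l : Filter ℕ) ≤ atTop := hyperfilter_le_cofinite.trans Nat.cofinite_eq_atTop.le
  let A := cesaroLaw P x₀
  obtain ⟨w, hw⟩ : ∃ w : X → ℝ≥0∞, Tendsto (fun n x => A n x) l (𝓝 w) :=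
    ⟨_, (l.map fun n x => A n x).le_nhds_lim⟩
  have hlim : ∀ x, Tendsto (fun n => A n x) l (𝓝 (w x)) := tendsto_pi_nhds.1 hw
  have hmass : ∑' x, w x = 1 := tsum_eq_one_of_tendsto hlim hW (ENNReal.add_ne_top.2 ⟨hV, hC⟩)
    (mean_cesaroLaw_le x₀ hdrift)
  let μ : PMF X := ⟨w, hmass ▸ ENNReal.summable.hasSum⟩
  have hbind_sum : ∀ (ν : PMF X) y, ν.bind P y = ∑ x ∈ (hpred y).toFinset, ν x * P x y := by
    intro ν y
    rw [PMF.bind_apply]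
    exact tsum_eq_sum fun x hx => by simp_all
  have hbind : ∀ y, Tendsto (fun n => (A n).bind P y) l (𝓝 (μ.bind P y)) := by
    intro y
    simp only [hbind_sum]
    exact tendsto_finsetSum _ fun x _ =>
      ENNReal.Tendsto.mul_const (hlim x) (Or.inr ((P x).apply_ne_top y))
  refine ⟨μ, PMF.ext fun y => ?_⟩
  have hleft := (hbind y).add
    ((tendsto_pmf_apply_div_atTop_zero (fun _ => lawAt P x₀ 0) y).mono_left hl)
  have hright := (hlim y).add
    ((tendsto_pmf_apply_div_atTop_zero (fun n => lawAt P x₀ (n + 1)) y).mono_left hl)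
  simp only [A, bind_cesaroLaw_apply_add] at hleft
  rw [add_zero] at hleft hright
  exact tendsto_nhds_unique hleft hright

end KrylovBogoliubov

section Uniformization

variable (q : X → X → ℝ≥0∞) {L : ℝ≥0∞} (hL0 : L ≠ 0) (hL : L ≠ ∞) (hq : ∀ x, ∑' y, q x y ≤ L)

open Classical in
/-- The uniformization of the jump rates `q`: the discrete chain that observes the jump chain at
the points of a Poisson clock whose rate `L` dominates all the exit rates. -/
noncomputable def uniformization (x : X) : PMF X :=
  ⟨fun y => (q x y + if y = x then L - ∑' z, q x z else 0) / L, by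
    have hsum : ∑' y, (q x y + if y = x then L - ∑' z, q x z else 0) / L = 1 := by
      simp only [div_eq_mul_inv]
      rw [ENNReal.tsum_mul_right, ENNReal.tsum_add, tsum_ite_eq, add_tsub_cancel_of_le (hq x),
        ENNReal.mul_inv_cancel hL0 hL]
    exact hsum ▸ ENNReal.summable.hasSum⟩

open Classical in
theorem uniformization_apply (x y : X) :
    uniformization q hL0 hL hq x y = (q x y + if y = x then L - ∑' z, q x z else 0) / L :=
  rfl

theorem mean_uniformization (f : X → ℝ≥0∞) (x : X) :
    mean (uniformization q hL0 hL hq x) f =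
      (∑' y, q x y * f y + (L - ∑' z, q x z) * f x) / L := by
  classical
  simp only [mean, uniformization_apply, div_eq_mul_inv, mul_right_comm _ L⁻¹, add_mul _ _ (f _),
    ite_mul, zero_mul]
  rw [ENNReal.tsum_mul_right, ENNReal.tsum_add, tsum_ite_eq x fun y => (L - ∑' z, q x z) * f y]

theorem bind_uniformization_apply (μ : PMF X) (y : X) :
    μ.bind (uniformization q hL0 hL hq) y =
      (∑' x, μ x * q x y + μ y * (L - ∑' z, q y z)) / L := by
  classical
  simp only [PMF.bind_apply, uniformization_apply, div_eq_mul_inv, ← mul_assoc, mul_add, mul_ite,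
    mul_zero, eq_comm (a := y)]
  rw [ENNReal.tsum_mul_right, ENNReal.tsum_add, tsum_ite_eq y fun x => μ x * (L - ∑' z, q x z)]

theorem balanced_iff_bind_uniformization_eq (μ : PMF X) :
    Balanced q μ ↔ μ.bind (uniformization q hL0 hL hq) = μ := by
  rw [PMF.ext_iff]
  refine forall_congr' fun y => ?_
  have hsplit : L * μ y = μ y * ∑' z, q y z + μ y * (L - ∑' z, q y z) := by
    rw [← mul_add, add_tsub_cancel_of_le (hq y), mul_comm]
  have hfin : μ y * (L - ∑' z, q y z) ≠ ∞ :=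
    ENNReal.mul_ne_top (μ.apply_ne_top y) (ne_top_of_le_ne_top hL tsub_le_self)
  rw [bind_uniformization_apply, eq_comm (b := μ y), ENNReal.eq_div_iff hL0 hL, hsplit,
    ENNReal.add_left_inj hfin, eq_comm]

end Uniformization

theorem exists_balanced_of_drift (q : X → X → ℝ≥0∞) {L : ℝ≥0∞} (hL0 : L ≠ 0) (hL : L ≠ ∞)
    (hq : ∀ x, ∑' y, q x y ≤ L) (hpred : ∀ y, {x | q x y ≠ 0}.Finite) {V W : X → ℝ≥0∞}
    {C : ℝ≥0∞} (hC : C ≠ ∞) {x₀ : X} (hV : V x₀ ≠ ∞) (hW : ∀ n : ℕ, {x | W x ≤ n}.Finite)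
    (hdrift : ∀ x, ∑' y, q x y * V y + W x ≤ (∑' y, q x y) * V x + C) :
    ∃ μ : PMF X, Balanced q μ := by
  let P := uniformization q hL0 hL hq
  have hpredP : ∀ y, {x | P x y ≠ 0}.Finite := by
    refine fun y => ((hpred y).union (Set.finite_singleton y)).subset fun x hx => ?_
    by_contra hxy
    simp_all [P, uniformization_apply, eq_comm (a := y)]
  have hWL : ∀ n : ℕ, {x | W x / L ≤ n}.Finite := by
    intro n
    obtain ⟨l, hl⟩ := ENNReal.exists_nat_gt hL
    refine (hW (n * l)).subset fun x hx => ?_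
    have hWx : W x ≤ n * L := (ENNReal.div_le_iff hL0 hL).1 hx
    push_cast [Set.mem_ofPred_eq]
    exact hWx.trans (by gcongr)
  have hdriftL : ∀ x, mean (P x) V + W x / L ≤ V x + C / L := by
    intro x
    rw [mean_uniformization, ← ENNReal.add_div]
    refine ENNReal.div_le_of_le_mul ?_
    rw [add_mul, ENNReal.div_mul_cancel hL0 hL]
    calc _ = (∑' y, q x y * V y + W x) + (L - ∑' z, q x z) * V x := by ring
      _ ≤ ((∑' y, q x y) * V x + C) + (L - ∑' z, q x z) * V x :=
        add_le_add_left (hdrift x) _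
      _ = (∑' y, q x y + (L - ∑' z, q x z)) * V x + C := by ring
      _ = V x * L + C := by rw [add_tsub_cancel_of_le (hq x), mul_comm]
  obtain ⟨μ, hμ⟩ :=
    exists_bind_eq_of_drift x₀ hpredP hV (ENNReal.div_ne_top hC hL0) hWL hdriftL
  exact ⟨μ, (balanced_iff_bind_uniformization_eq q hL0 hL hq μ).2 hμ⟩

end MarkovJump

namespace BatchFilling

open MarkovJump
open scoped ENNReal

section QueueSum

/-- The additive statistic `∑ x ∈ t, φ x` of the queue lengths `t`. -/
def queueSum (φ : ℕ → ℝ) (t : Multiset ℕ) : ℝ := (t.map φ).sum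

variable {φ ψ : ℕ → ℝ} {t : Multiset ℕ}

theorem queueSum_cons (φ : ℕ → ℝ) (x : ℕ) (t : Multiset ℕ) :
    queueSum φ (x ::ₘ t) = φ x + queueSum φ t := by
  rw [queueSum, Multiset.map_cons, Multiset.sum_cons, queueSum]

theorem queueSum_add (φ : ℕ → ℝ) (s t : Multiset ℕ) :
    queueSum φ (s + t) = queueSum φ s + queueSum φ t := by
  rw [queueSum, Multiset.map_add, Multiset.sum_add, queueSum, queueSum]

theorem queueSum_mono (h : ∀ x, φ x ≤ ψ x) : queueSum φ t ≤ queueSum ψ t :=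
  Multiset.sum_map_le_sum_map _ _ fun x _ => h x

theorem queueSum_const (c : ℝ) (t : Multiset ℕ) : queueSum (fun _ => c) t = t.card * c := by
  rw [queueSum, Multiset.map_const', Multiset.sum_replicate, nsmul_eq_mul]

theorem queueSum_sub (φ ψ : ℕ → ℝ) (t : Multiset ℕ) :
    queueSum (fun x => φ x - ψ x) t = queueSum φ t - queueSum ψ t :=
  Multiset.sum_map_sub

theorem queueSum_const_add_mul (c b : ℝ) (φ : ℕ → ℝ) (t : Multiset ℕ) :
    queueSum (fun x => c + b * φ x) t = t.card * c + b * queueSum φ t := by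
  rw [← queueSum_const, queueSum, Multiset.sum_map_add, Multiset.sum_map_mul_left, queueSum,
    queueSum]

theorem queueSum_nonneg (h : ∀ x, 0 ≤ φ x) : 0 ≤ queueSum φ t :=
  Multiset.sum_nonneg fun y hy => by
    obtain ⟨x, -, rfl⟩ := Multiset.mem_map.1 hy
    exact h x

theorem le_queueSum_of_mem (h : ∀ x, 0 ≤ φ x) {x : ℕ} (hx : x ∈ t) : φ x ≤ queueSum φ t := by
  rw [← Multiset.cons_erase hx, queueSum_cons]
  exact le_add_of_nonneg_right (queueSum_nonneg h)

end QueueSum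

section Fill

theorem exists_assignOne_eq_cons {a : Multiset ℕ} (ha : a ≠ 0) :
    ∃ x t, a = x ::ₘ t ∧ assignOne a = (x + 1) ::ₘ t ∧ ∀ y ∈ a, x ≤ y := by
  have hmin : sInf {x | x ∈ a} ∈ a :=
    Nat.sInf_mem (s := {x | x ∈ a}) (Multiset.exists_mem_of_ne_zero ha)
  exact ⟨_, _, (Multiset.cons_erase hmin).symm, by rw [assignOne, if_neg ha],
    fun y hy => Nat.sInf_le hy⟩

theorem card_assignOne (a : Multiset ℕ) : (assignOne a).card = a.card := by
  rcases eq_or_ne a 0 with rfl | ha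
  · rfl
  · obtain ⟨x, t, rfl, hassign, -⟩ := exists_assignOne_eq_cons ha
    rw [hassign, Multiset.card_cons, Multiset.card_cons]

theorem fill_succ (k : ℕ) (a : Multiset ℕ) : fill (k + 1) a = assignOne (fill k a) :=
  Function.iterate_succ_apply' _ _ _

theorem card_fill (k : ℕ) (a : Multiset ℕ) : (fill k a).card = a.card := by
  induction k with
  | zero => rfl
  | succ k ih => rw [fill_succ, card_assignOne, ih]

theorem fill_ne_zero (k : ℕ) {a : Multiset ℕ} (ha : a ≠ 0) : fill k a ≠ 0 := by
  rwa [← Multiset.card_pos, card_fill, Multiset.card_pos]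

theorem queueSum_natCast_fill (k : ℕ) {a : Multiset ℕ} (ha : a ≠ 0) :
    queueSum Nat.cast (fill k a) = queueSum Nat.cast a + k := by
  induction k with
  | zero => simp [fill]
  | succ k ih =>
    obtain ⟨x, t, hfill, hassign, -⟩ := exists_assignOne_eq_cons (fill_ne_zero k ha)
    rw [hfill, queueSum_cons] at ih
    rw [fill_succ, hassign, queueSum_cons]
    push_cast
    linarith

theorem card_mul_le_queueSum {a : Multiset ℕ} {x : ℕ} (hx : ∀ y ∈ a, x ≤ y) :
    (a.card * x : ℝ) ≤ queueSum Nat.cast a := by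
  rw [← queueSum_const]
  exact Multiset.sum_map_le_sum_map _ _ fun y hy => by exact_mod_cast hx y hy

/-- A task joins a shortest queue, of length at most the mean length, so that it raises the sum of
the squares by at most twice that mean plus one. -/
theorem queueSum_sq_fill_le (k : ℕ) {a : Multiset ℕ} (ha : a ≠ 0) :
    queueSum (fun x => (x : ℝ) ^ 2) (fill k a) ≤
      queueSum (fun x => (x : ℝ) ^ 2) a + 2 * k / a.card * queueSum Nat.cast a + k ^ 2 := by
  have hcard : (1 : ℝ) ≤ a.card := by exact_mod_cast Multiset.card_pos.2 ha
  induction k with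
  | zero => simp [fill]
  | succ k ih =>
    obtain ⟨x, t, hfill, hassign, hmin⟩ := exists_assignOne_eq_cons (fill_ne_zero k ha)
    have hx : (x : ℝ) ≤ queueSum Nat.cast a / a.card + k := by
      have h := card_mul_le_queueSum hmin
      rw [card_fill, queueSum_natCast_fill k ha] at h
      rw [← sub_le_iff_le_add, le_div_iff₀ (by positivity)]
      nlinarith [(Nat.cast_nonneg k : (0 : ℝ) ≤ k)]
    rw [hfill, queueSum_cons] at ih
    rw [fill_succ, hassign, queueSum_cons]
    push_cast
    calc ((x : ℝ) + 1) ^ 2 + queueSum (fun x => (x : ℝ) ^ 2) t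
        = (x : ℝ) ^ 2 + queueSum (fun x => (x : ℝ) ^ 2) t + 2 * x + 1 := by ring
      _ ≤ queueSum (fun x => (x : ℝ) ^ 2) a + 2 * k / a.card * queueSum Nat.cast a + k ^ 2 +
          2 * (queueSum Nat.cast a / a.card + k) + 1 := by gcongr
      _ = _ := by ring

end Fill

section Transitions

/-- The queue lengths `t` after the `k` tasks of a job have been assigned to the sample `a ≤ t`. -/
noncomputable def afterArrival (k : ℕ) (t a : Multiset ℕ) : Multiset ℕ := t - a + fill k a

/-- The queue lengths `t` after a task completion at a queue of length `x ∈ t`. By truncated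
subtraction an empty queue leaves `t` as it is. -/
def afterDeparture (t : Multiset ℕ) (x : ℕ) : Multiset ℕ := (x - 1) ::ₘ t.erase x

variable {t a : Multiset ℕ} {x : ℕ}

theorem card_afterArrival (k : ℕ) (h : a ≤ t) : (afterArrival k t a).card = t.card := by
  rw [afterArrival, Multiset.card_add, card_fill, ← Multiset.card_add, tsub_add_cancel_of_le h]

theorem card_afterDeparture (hx : x ∈ t) : (afterDeparture t x).card = t.card := by
  rw [afterDeparture, Multiset.card_cons, Multiset.card_erase_add_one hx]

theorem queueSum_afterArrival (φ : ℕ → ℝ) (k : ℕ) (h : a ≤ t) :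
    queueSum φ (afterArrival k t a) = queueSum φ t + (queueSum φ (fill k a) - queueSum φ a) := by
  have hsplit := queueSum_add φ (t - a) a
  rw [tsub_add_cancel_of_le h] at hsplit
  rw [afterArrival, queueSum_add, hsplit]
  ring

theorem queueSum_afterDeparture (φ : ℕ → ℝ) (hx : x ∈ t) :
    queueSum φ (afterDeparture t x) = queueSum φ t + (φ (x - 1) - φ x) := by
  have hsplit := queueSum_cons φ x (t.erase x)
  rw [Multiset.cons_erase hx] at hsplit
  rw [afterDeparture, queueSum_cons, hsplit]
  ring

end Transitions

section SampleMean

/-- The mean of `f` over a uniformly random sample of `m` of the queues `t`, drawn without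
replacement. -/
noncomputable def sampleMean (m : ℕ) (t : Multiset ℕ) (f : Multiset ℕ → ℝ) : ℝ :=
  ((t.powersetCard m).map f).sum / t.card.choose m

variable {m : ℕ} {t : Multiset ℕ} {f g : Multiset ℕ → ℝ}

theorem sampleMean_mono (h : ∀ a ≤ t, a.card = m → f a ≤ g a) :
    sampleMean m t f ≤ sampleMean m t g := by
  refine div_le_div_of_nonneg_right (Multiset.sum_map_le_sum_map _ _ fun a ha => ?_)
    (Nat.cast_nonneg _)
  obtain ⟨hat, ham⟩ := Multiset.mem_powersetCard.1 ha
  exact h a hat ham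

theorem sampleMean_congr (h : ∀ a ≤ t, a.card = m → f a = g a) :
    sampleMean m t f = sampleMean m t g :=
  le_antisymm (sampleMean_mono fun a hat ham => (h a hat ham).le)
    (sampleMean_mono fun a hat ham => (h a hat ham).ge)

theorem sampleMean_const (hm : m ≤ t.card) (c : ℝ) : sampleMean m t (fun _ => c) = c := by
  have hchoose : (t.card.choose m : ℝ) ≠ 0 := by exact_mod_cast (Nat.choose_pos hm).ne'
  rw [sampleMean, Multiset.map_const', Multiset.sum_replicate, Multiset.card_powersetCard,
    nsmul_eq_mul, mul_div_cancel_left₀ c hchoose]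

theorem sampleMean_add (m : ℕ) (t : Multiset ℕ) (f g : Multiset ℕ → ℝ) :
    sampleMean m t (fun a => f a + g a) = sampleMean m t f + sampleMean m t g := by
  rw [sampleMean, Multiset.sum_map_add, add_div, sampleMean, sampleMean]

theorem sampleMean_const_mul (m : ℕ) (t : Multiset ℕ) (c : ℝ) (f : Multiset ℕ → ℝ) :
    sampleMean m t (fun a => c * f a) = c * sampleMean m t f := by
  rw [sampleMean, Multiset.sum_map_mul_left, mul_div_assoc, sampleMean]

/-- Each queue lies in `(card t - 1).choose m` of the samples of size `m + 1`. -/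
theorem sum_map_queueSum_powersetCard_succ (φ : ℕ → ℝ) (m : ℕ) (t : Multiset ℕ) :
    ((t.powersetCard (m + 1)).map (queueSum φ)).sum =
      (t.card - 1).choose m * queueSum φ t := by
  induction t using Multiset.induction_on generalizing m with
  | empty => simp [Multiset.powersetCard_zero_right, queueSum]
  | cons x t ih =>
    have hcons : ((t.powersetCard m).map fun a => queueSum φ (x ::ₘ a)).sum =
        t.card.choose m * φ x + ((t.powersetCard m).map (queueSum φ)).sum := by
      simp only [queueSum_cons, Multiset.sum_map_add, Multiset.map_const', Multiset.sum_replicate,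
        Multiset.card_powersetCard, nsmul_eq_mul]
    rw [Multiset.powersetCard_cons, Multiset.map_add, Multiset.sum_add, Multiset.map_map, ih]
    simp only [Function.comp_def]
    rw [hcons, queueSum_cons, Multiset.card_cons, Nat.add_sub_cancel]
    rcases eq_or_ne t 0 with rfl | ht
    · cases m <;> simp [Multiset.powersetCard_zero_right, queueSum]
    obtain ⟨n, hn⟩ := Nat.exists_eq_succ_of_ne_zero (Multiset.card_pos.2 ht).ne'
    cases m with
    | zero => simp [queueSum, add_comm]
    | succ m =>
      rw [ih, hn, Nat.succ_sub_one, Nat.choose_succ_succ]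
      push_cast
      ring

theorem sampleMean_queueSum (hm : m ≤ t.card) (φ : ℕ → ℝ) :
    sampleMean m t (queueSum φ) = m / t.card * queueSum φ t := by
  cases m with
  | zero => simp [sampleMean, queueSum]
  | succ m =>
    obtain ⟨n, hn⟩ := Nat.exists_eq_succ_of_ne_zero (Nat.ne_zero_of_lt hm)
    have hchoose : ((n + 1).choose (m + 1) : ℝ) ≠ 0 := by
      exact_mod_cast (Nat.choose_pos (hn ▸ hm)).ne'
    have habsorb : ((n + 1 : ℕ) : ℝ) * n.choose m = (n + 1).choose (m + 1) * (m + 1 : ℕ) := by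
      exact_mod_cast Nat.add_one_mul_choose_eq n m
    rw [sampleMean, sum_map_queueSum_powersetCard_succ, hn, Nat.succ_sub_one, Nat.succ_eq_add_one]
    field_simp
    linear_combination queueSum φ t * habsorb

end SampleMean

section Generator

/-- The generator of the chain with parameters `lam`, `k` and `m`, applied to `f`. The empty queues
need no separate treatment: they contribute `0` since `afterDeparture t 0 = t` if `0 ∈ t`. -/
noncomputable def generator (lam : ℝ) (k m : ℕ) (f : Multiset ℕ → ℝ) (t : Multiset ℕ) : ℝ :=
  t.card * lam / k * sampleMean m t (fun a => f (afterArrival k t a) - f t) +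
    (t.map fun x => f (afterDeparture t x) - f t).sum

theorem generator_queueSum (lam : ℝ) (k m : ℕ) (φ : ℕ → ℝ) (t : Multiset ℕ) :
    generator lam k m (queueSum φ) t =
      t.card * lam / k * sampleMean m t (fun a => queueSum φ (fill k a) - queueSum φ a) +
        queueSum (fun x => φ (x - 1) - φ x) t := by
  rw [generator, queueSum.eq_1 fun x => φ (x - 1) - φ x,
    sampleMean_congr fun a hat _ => sub_eq_of_eq_add' (queueSum_afterArrival φ k hat),
    Multiset.map_congr rfl fun x hx => sub_eq_of_eq_add' (queueSum_afterDeparture φ hx)]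

/-- The transition rates with values in `ℝ≥0∞`, for which stationarity is `Balanced`. -/
noncomputable def jumpRate {N : ℕ} (lam : ℝ) (k m : ℕ) (s s' : State N) : ℝ≥0∞ :=
  .ofReal (rate lam k m s s')

theorem isStationary_iff_balanced {N : ℕ} {lam : ℝ} {k m : ℕ} {π : PMF (State N)} :
    IsStationary lam k m π ↔ Balanced (jumpRate lam k m) π :=
  Iff.rfl

theorem hasSum_countP_mul {ι Y Z : Type*} [DecidableEq Z] {e : Y → Z} (he : Function.Injective e)
    (F : Z → ℝ) {g : ι → Z} {M : Multiset ι} (hg : ∀ a ∈ M, g a ∈ Set.range e) :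
    HasSum (fun y => (M.countP (fun a => g a = e y) : ℝ) * F (e y))
      (M.map fun a => F (g a)).sum := by
  classical
  induction M using Multiset.induction_on with
  | empty => simp [hasSum_zero]
  | cons a M ih =>
    obtain ⟨y₀, hy₀⟩ := hg a (Multiset.mem_cons_self a M)
    rw [Multiset.map_cons, Multiset.sum_cons]
    refine ((hasSum_ite_eq y₀ (F (g a))).add
      (ih fun b hb => hg b (Multiset.mem_cons_of_mem hb))).congr_fun fun y => ?_
    rw [Multiset.countP_cons, ← hy₀]
    rcases eq_or_ne y y₀ with rfl | hy
    · simp [add_mul, add_comm]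
    · simp [hy, he.ne hy.symm]

variable {N : ℕ} (lam : ℝ) (k m : ℕ) (s : State N)

theorem hasSum_arrivalRate_mul (F : Multiset ℕ → ℝ) :
    HasSum (fun s' : State N => arrivalRate lam k m s s' * F s')
      (N * lam / k * sampleMean m s fun a => F (afterArrival k s a)) := by
  have hsum := hasSum_countP_mul (e := fun s' : State N => (s' : Multiset ℕ)) Subtype.val_injective
    F (g := afterArrival k s) (M := (s : Multiset ℕ).powersetCard m) fun a ha =>
      ⟨⟨_, (card_afterArrival k (Multiset.mem_powersetCard.1 ha).1).trans s.2⟩, rfl⟩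
  rw [sampleMean, Sym.card_coe]
  refine ((hsum.div_const (N.choose m : ℝ)).mul_left (N * lam / k)).congr_fun fun s' => ?_
  change N * lam / k * (((s : Multiset ℕ).powersetCard m).countP
    (fun a => afterArrival k s a = s') / (N.choose m : ℝ)) * F s' = _
  ring

theorem hasSum_departureRate_mul (F : Multiset ℕ → ℝ) :
    HasSum (fun s' : State N => departureRate s s' * F s')
      (((s : Multiset ℕ).filter (0 < ·)).map fun x => F (afterDeparture s x)).sum := by
  refine (hasSum_countP_mul (e := fun s' : State N => (s' : Multiset ℕ)) Subtype.val_injective F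
    (g := afterDeparture s) fun x hx =>
      ⟨⟨_, (card_afterDeparture (Multiset.mem_of_mem_filter hx)).trans s.2⟩, rfl⟩).congr_fun
        fun s' => ?_
  rw [departureRate, Multiset.countP_filter]
  simp only [and_comm, afterDeparture]
  congr

theorem sum_map_filter_pos_afterDeparture (f : Multiset ℕ → ℝ) (t : Multiset ℕ) :
    ((t.filter (0 < ·)).map fun x => f (afterDeparture t x) - f t).sum =
      (t.map fun x => f (afterDeparture t x) - f t).sum := by
  have hempty : ∀ x ∈ t.filter (¬0 < ·), f (afterDeparture t x) - f t = 0 := by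
    intro x hx
    obtain ⟨hxt, hx0⟩ := Multiset.mem_filter.1 hx
    obtain rfl : x = 0 := Nat.eq_zero_of_not_pos hx0
    rw [afterDeparture, Nat.zero_sub, Multiset.cons_erase hxt, sub_self]
  conv_rhs =>
    arg 1; arg 2
    rw [← Multiset.filter_add_not (0 < ·) t]
  rw [Multiset.map_add, Multiset.sum_add, Multiset.map_congr rfl hempty, Multiset.sum_map_zero,
    add_zero]

theorem hasSum_rate_mul_sub (f : Multiset ℕ → ℝ) :
    HasSum (fun s' : State N => rate lam k m s s' * (f s' - f s)) (generator lam k m f s) := by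
  rw [generator, ← sum_map_filter_pos_afterDeparture, Sym.card_coe]
  simp only [rate, add_mul]
  exact (hasSum_arrivalRate_mul lam k m s fun t => f t - f s).add
    (hasSum_departureRate_mul s fun t => f t - f s)

theorem hasSum_rate (hm : m ≤ N) :
    HasSum (fun s' => rate lam k m s s')
      (N * lam / k + ((s : Multiset ℕ).filter (0 < ·)).card) := by
  have harr := hasSum_arrivalRate_mul lam k m s fun _ => 1
  have hdep := hasSum_departureRate_mul s fun _ => 1
  rw [sampleMean_const (hm.trans_eq Sym.card_coe.symm)] at harr
  simpa [rate] using harr.add hdep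

variable {lam k m}

theorem rate_nonneg (hlam : 0 ≤ lam) (s' : State N) : 0 ≤ rate lam k m s s' := by
  unfold rate arrivalRate departureRate
  positivity

theorem tsum_jumpRate (hlam : 0 ≤ lam) (hm : m ≤ N) :
    ∑' s', jumpRate lam k m s s' = .ofReal (∑' s', rate lam k m s s') :=
  (ENNReal.ofReal_tsum_of_nonneg (rate_nonneg s hlam) (hasSum_rate lam k m s hm).summable).symm

theorem tsum_jumpRate_le (hlam : 0 ≤ lam) (hm : m ≤ N) :
    ∑' s', jumpRate lam k m s s' ≤ .ofReal (N * lam / k + N) := by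
  rw [tsum_jumpRate s hlam hm, (hasSum_rate lam k m s hm).tsum_eq]
  have hbusy : ((s : Multiset ℕ).filter (0 < ·)).card ≤ N :=
    (Multiset.card_le_card (Multiset.filter_le _ _)).trans_eq s.2
  gcongr

theorem hasSum_rate_mul (hm : m ≤ N) (f : Multiset ℕ → ℝ) :
    HasSum (fun s' : State N => rate lam k m s s' * f s')
      (generator lam k m f s + (∑' s', rate lam k m s s') * f s) := by
  simpa only [← mul_add, sub_add_cancel] using (hasSum_rate_mul_sub lam k m s f).add
    ((hasSum_rate lam k m s hm).summable.hasSum.mul_right (f s))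

theorem tsum_jumpRate_mul (hlam : 0 ≤ lam) (hm : m ≤ N) {f : Multiset ℕ → ℝ} (hf : ∀ t, 0 ≤ f t) :
    ∑' s', jumpRate lam k m s s' * .ofReal (f s') =
      .ofReal (generator lam k m f s + (∑' s', rate lam k m s s') * f s) := by
  have hsum := hasSum_rate_mul (lam := lam) (k := k) s hm f
  simp only [jumpRate, ← ENNReal.ofReal_mul (rate_nonneg s hlam _)]
  rw [← hsum.tsum_eq, ENNReal.ofReal_tsum_of_nonneg
    (fun s' => mul_nonneg (rate_nonneg s hlam s') (hf s')) hsum.summable]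

theorem tsum_jumpRate_mul_add_le (hlam : 0 ≤ lam) (hm : m ≤ N) {f : Multiset ℕ → ℝ}
    (hf : ∀ t, 0 ≤ f t) {u v : ℝ} (hu : 0 ≤ u) (hv : 0 ≤ v)
    (h : generator lam k m f s + u ≤ v) :
    ∑' s', jumpRate lam k m s s' * .ofReal (f s') + .ofReal u ≤
      (∑' s', jumpRate lam k m s s') * .ofReal (f s) + .ofReal v := by
  have hrate : 0 ≤ ∑' s', rate lam k m s s' := tsum_nonneg (rate_nonneg s hlam)
  have hflow : 0 ≤ generator lam k m f s + (∑' s', rate lam k m s s') * f s :=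
    (hasSum_rate_mul s hm f).nonneg fun s' => mul_nonneg (rate_nonneg s hlam s') (hf s')
  rw [tsum_jumpRate_mul s hlam hm hf, tsum_jumpRate s hlam hm, ← ENNReal.ofReal_mul hrate,
    ← ENNReal.ofReal_add hflow hu, ← ENNReal.ofReal_add (mul_nonneg hrate (hf s)) hv]
  refine ENNReal.ofReal_le_ofReal ?_
  linarith

theorem le_tsum_jumpRate_mul_add (hlam : 0 ≤ lam) (hm : m ≤ N) {f : Multiset ℕ → ℝ}
    (hf : ∀ t, 0 ≤ f t) {u v : ℝ} (hu : 0 ≤ u) (h : u ≤ generator lam k m f s + v) :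
    (∑' s', jumpRate lam k m s s') * .ofReal (f s) + .ofReal u ≤
      ∑' s', jumpRate lam k m s s' * .ofReal (f s') + .ofReal v := by
  have hrate : 0 ≤ ∑' s', rate lam k m s s' := tsum_nonneg (rate_nonneg s hlam)
  rw [tsum_jumpRate_mul s hlam hm hf, tsum_jumpRate s hlam hm, ← ENNReal.ofReal_mul hrate,
    ← ENNReal.ofReal_add (mul_nonneg hrate (hf s)) hu]
  refine (ENNReal.ofReal_le_ofReal ?_).trans ENNReal.ofReal_add_le
  linarith

end Generator

section Drift

/-- The number of the queues `t` that are shorter than `i`. -/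
def shortCount (i : ℕ) : Multiset ℕ → ℝ := queueSum fun x => if x < i then 1 else 0

variable {lam : ℝ} {k m : ℕ} {t : Multiset ℕ}

theorem shortCount_nonneg (i : ℕ) (t : Multiset ℕ) : 0 ≤ shortCount i t :=
  queueSum_nonneg fun x => by split_ifs <;> simp

theorem shortCount_le_card (i : ℕ) (t : Multiset ℕ) : shortCount i t ≤ t.card := by
  rw [← mul_one (t.card : ℝ), ← queueSum_const]
  exact queueSum_mono fun x => by split_ifs <;> simp

theorem countP_le_eq_card_sub_shortCount (i : ℕ) (t : Multiset ℕ) :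
    (t.countP (i ≤ ·) : ℝ) = t.card - shortCount i t := by
  induction t using Multiset.induction_on with
  | empty => simp [shortCount, queueSum]
  | cons x t ih =>
    rw [shortCount] at ih ⊢
    rw [queueSum_cons, Multiset.countP_cons, Multiset.card_cons]
    push_cast
    rcases lt_or_ge x i with hx | hx
    · simp [hx, hx.not_ge, ih]
      ring
    · simp [hx, hx.not_gt, ih]
      ring

theorem generator_queueSum_sq_le (hlam : 0 ≤ lam) (hk : 0 < k) (hm0 : 0 < m) (hm : m ≤ t.card) :
    generator lam k m (queueSum fun x => (x : ℝ) ^ 2) t ≤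
      t.card * (lam * k + 1) - 2 * (1 - lam) * queueSum Nat.cast t := by
  have hcard : (0 : ℝ) < t.card := by exact_mod_cast hm0.trans_le hm
  have : (0 : ℝ) < k := by exact_mod_cast hk
  have : (0 : ℝ) < m := by exact_mod_cast hm0
  have harrival : sampleMean m t (fun a => queueSum (fun x => (x : ℝ) ^ 2) (fill k a) -
      queueSum (fun x => (x : ℝ) ^ 2) a) ≤ 2 * k / t.card * queueSum Nat.cast t + k ^ 2 := by
    calc _ ≤ sampleMean m t fun a => 2 * k / m * queueSum Nat.cast a + k ^ 2 := by
          refine sampleMean_mono fun a _ ham => ?_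
          have ha : a ≠ 0 := Multiset.card_pos.1 (ham ▸ hm0)
          rw [sub_le_iff_le_add', ← add_assoc, ← ham]
          exact queueSum_sq_fill_le k ha
      _ = 2 * k / m * (m / t.card * queueSum Nat.cast t) + k ^ 2 := by
          rw [sampleMean_add, sampleMean_const_mul, sampleMean_queueSum hm, sampleMean_const hm]
      _ = _ := by field_simp
  have hdeparture : queueSum (fun x => ((x - 1 : ℕ) : ℝ) ^ 2 - (x : ℝ) ^ 2) t ≤
      t.card * 1 + -2 * queueSum Nat.cast t := by
    rw [← queueSum_const_add_mul]
    refine queueSum_mono fun x => ?_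
    cases x with
    | zero => simp
    | succ x => push_cast [Nat.add_sub_cancel]; linarith
  rw [generator_queueSum]
  calc _ ≤ t.card * lam / k * (2 * k / t.card * queueSum Nat.cast t + k ^ 2) +
        (t.card * 1 + -2 * queueSum Nat.cast t) := by gcongr
    _ = _ := by field_simp; ring

/-- Truncation at `n` makes the number of tasks bounded, at the price of losing the arrivals to the
states where it is not below `n - k`. -/
theorem le_generator_min_queueSum (hlam : 0 ≤ lam) (hk : 0 < k) (hm0 : 0 < m) (hm : m ≤ t.card)
    (n : ℝ) :
    (if queueSum Nat.cast t + k ≤ n then t.card * lam else 0) ≤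
      generator lam k m (fun t => min (queueSum Nat.cast t) n) t + (t.card - shortCount 1 t) := by
  have : (0 : ℝ) < k := by exact_mod_cast hk
  have harrival : (if queueSum Nat.cast t + k ≤ n then (k : ℝ) else 0) ≤ sampleMean m t fun a =>
      min (queueSum Nat.cast (afterArrival k t a)) n - min (queueSum Nat.cast t) n := by
    rw [← sampleMean_const hm (ite _ _ _)]
    refine sampleMean_mono fun a hat ham => ?_
    rw [queueSum_afterArrival _ k hat,
      queueSum_natCast_fill k (Multiset.card_pos.1 (ham ▸ hm0)), add_sub_cancel_left]
    split_ifs with hn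
    · rw [min_eq_left hn, min_eq_left (by linarith), add_sub_cancel_left]
    · exact sub_nonneg.2 (min_le_min_right n (by linarith))
  have hdeparture : t.card * (-1) + 1 * shortCount 1 t ≤ (t.map fun x =>
      min (queueSum Nat.cast (afterDeparture t x)) n - min (queueSum Nat.cast t) n).sum := by
    rw [shortCount, ← queueSum_const_add_mul]
    refine Multiset.sum_map_le_sum_map _ _ fun x hx => ?_
    rw [queueSum_afterDeparture _ hx]
    cases x with
    | zero => simp
    | succ x =>
      have hmin : min (queueSum Nat.cast t) n - 1 ≤ min (queueSum Nat.cast t - 1) n := by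
        rw [← min_sub_sub_right]
        exact min_le_min_left _ (sub_le_self n zero_le_one)
      have hstep : (((x + 1 - 1 : ℕ) : ℝ) - (x + 1 : ℕ)) = -1 := by
        push_cast [Nat.add_sub_cancel]
        ring
      rw [hstep, ← sub_eq_add_neg, if_neg (by omega)]
      linarith
  calc _ = t.card * lam / k * (if queueSum Nat.cast t + k ≤ n then (k : ℝ) else 0) := by
        split_ifs
        · field_simp
        · rw [mul_zero]
    _ ≤ t.card * lam / k * sampleMean m t (fun a =>
        min (queueSum Nat.cast (afterArrival k t a)) n - min (queueSum Nat.cast t) n) := by gcongr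
    _ ≤ _ := by rw [generator]; linarith

/-- A departure makes a queue of length `i` short, and at worst a job turns all the short queues of
its sample into longer ones. -/
theorem le_generator_shortCount (hlam : 0 ≤ lam) (hm0 : 0 < m) (hm : m ≤ t.card) {i : ℕ}
    (hi : 0 < i) :
    shortCount (i + 1) t ≤
      generator lam k m (shortCount i) t + (1 + lam * (m / k)) * shortCount i t := by
  have hcard : (0 : ℝ) < t.card := by exact_mod_cast hm0.trans_le hm
  have harrival : -1 * (m / t.card * shortCount i t) ≤ sampleMean m t fun a =>
      shortCount i (fill k a) - shortCount i a := by
    rw [shortCount, ← sampleMean_queueSum hm, ← sampleMean_const_mul]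
    refine sampleMean_mono fun a _ _ => ?_
    have hfill := shortCount_nonneg i (fill k a)
    rw [shortCount] at hfill
    linarith
  have hdeparture : queueSum (fun x => (if x - 1 < i then 1 else 0) - if x < i then (1 : ℝ) else 0)
      t = shortCount (i + 1) t - shortCount i t := by
    rw [shortCount, shortCount, ← queueSum_sub]
    refine congrArg (queueSum · t) (funext fun x => ?_)
    simp only [show x - 1 < i ↔ x < i + 1 by omega]
  have hgen : t.card * lam / k * (-1 * (m / t.card * shortCount i t)) +
      (shortCount (i + 1) t - shortCount i t) ≤ generator lam k m (shortCount i) t := by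
    rw [← hdeparture, shortCount.eq_1 i, generator_queueSum]
    gcongr
    exact harrival
  have hcancel : t.card * lam / k * (-1 * (m / t.card * shortCount i t)) =
      -(lam * (m / k) * shortCount i t) := by
    field_simp
  linarith

end Drift

namespace IsStationary

variable {N : ℕ} {lam : ℝ} {k m : ℕ} {π : PMF (State N)}

theorem mean_le_mean (hπ : IsStationary lam k m π) (hlam : 0 ≤ lam) (hm : m ≤ N)
    {f u v : Multiset ℕ → ℝ} {B : ℝ} (hf : ∀ t, 0 ≤ f t) (hB : ∀ s : State N, f s ≤ B)
    (hu : ∀ t, 0 ≤ u t) (h : ∀ s : State N, u s ≤ generator lam k m f s + v s) :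
    mean π (fun s => .ofReal (u s)) ≤ mean π fun s => .ofReal (v s) := by
  let out : State N → ℝ≥0∞ := fun s => (∑' s', jumpRate lam k m s s') * .ofReal (f s)
  have hout : mean π out ≠ ∞ := by
    refine ne_top_of_le_ne_top (b := .ofReal (N * lam / k + N) * .ofReal B)
      (ENNReal.mul_ne_top ENNReal.ofReal_ne_top ENNReal.ofReal_ne_top) ?_
    rw [← mean_const π (_ * _)]
    exact mean_mono π fun s =>
      mul_le_mul' (tsum_jumpRate_le s hlam hm) (ENNReal.ofReal_le_ofReal (hB s))
  have hflow : mean π (fun s => ∑' s', jumpRate lam k m s s' * .ofReal (f s')) = mean π out :=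
    (isStationary_iff_balanced.1 hπ).mean_tsum_rate_mul _
  refine (ENNReal.add_le_add_iff_left hout).1 ?_
  nth_rw 2 [← hflow]
  rw [← mean_add, ← mean_add]
  exact mean_mono π fun s => le_tsum_jumpRate_mul_add s hlam hm hf (hu s) (h s)

/-- Rate conservation: in the mean `N * lam` tasks arrive and `N - shortCount 1` are completed. -/
theorem mean_shortCount_one_le (hπ : IsStationary lam k m π) (hlam : 0 ≤ lam) (hk : 0 < k)
    (hm0 : 0 < m) (hm : m ≤ N) :
    mean π (fun s => .ofReal (shortCount 1 s)) ≤ .ofReal (N * (1 - lam)) := by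
  have hmin : ∀ n : ℕ, mean π (fun s => if queueSum Nat.cast s + k ≤ n then .ofReal (N * lam)
      else 0) ≤ mean π fun s => .ofReal (N - shortCount 1 s) := by
    intro n
    have hmean := hπ.mean_le_mean hlam hm (f := fun t => min (queueSum Nat.cast t) n)
      (u := fun t => if queueSum Nat.cast t + k ≤ n then t.card * lam else 0)
      (v := fun t => t.card - shortCount 1 t)
      (fun t => le_min (queueSum_nonneg Nat.cast_nonneg) (Nat.cast_nonneg n))
      (fun s => min_le_right _ _) (fun t => by split_ifs <;> positivity)
      (fun s => le_generator_min_queueSum hlam hk hm0 (hm.trans_eq Sym.card_coe.symm) n)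
    simpa only [Sym.card_coe, apply_ite ENNReal.ofReal, ENNReal.ofReal_zero] using hmean
  have hbusy := le_of_forall_mean_ite_le _ hmin
  have hsplit : mean π (fun s => .ofReal (N - shortCount 1 s)) +
      mean π (fun s => .ofReal (shortCount 1 s)) = .ofReal N := by
    rw [← mean_add, ← mean_const π (.ofReal N)]
    congr! 2 with s
    have hle : shortCount 1 s ≤ N := by simpa only [Sym.card_coe] using shortCount_le_card 1 s
    rw [← ENNReal.ofReal_add (sub_nonneg.2 hle) (shortCount_nonneg 1 s), sub_add_cancel]
  rw [mul_sub, mul_one, ENNReal.ofReal_sub _ (by positivity)]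
  refine ENNReal.le_sub_of_add_le_left ENNReal.ofReal_ne_top ?_
  rw [← hsplit]
  gcongr

theorem mean_shortCount_succ_le (hπ : IsStationary lam k m π) (hlam : 0 ≤ lam) (hm0 : 0 < m)
    (hm : m ≤ N) {i : ℕ} (hi : 0 < i) :
    mean π (fun s => .ofReal (shortCount (i + 1) s)) ≤
      .ofReal (1 + lam * (m / k)) * mean π fun s => .ofReal (shortCount i s) := by
  rw [← mean_const_mul]
  simp only [← ENNReal.ofReal_mul (show 0 ≤ 1 + lam * (m / k : ℝ) by positivity)]
  exact hπ.mean_le_mean hlam hm (f := shortCount i) (u := shortCount (i + 1))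
    (v := fun t => (1 + lam * (m / k)) * shortCount i t) (shortCount_nonneg i)
    (fun s => (shortCount_le_card i s).trans_eq (by rw [Sym.card_coe])) (shortCount_nonneg (i + 1))
    fun s => le_generator_shortCount hlam hm0 (hm.trans_eq Sym.card_coe.symm) hi

theorem mean_shortCount_le (hπ : IsStationary lam k m π) (hlam : 0 ≤ lam) (hlam1 : lam ≤ 1)
    (hk : 0 < k) (hm0 : 0 < m) (hm : m ≤ N) (i : ℕ) :
    mean π (fun s => .ofReal (shortCount (i + 1) s)) ≤
      .ofReal ((1 + m / k) ^ i * (N * (1 - lam))) := by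
  induction i with
  | zero => simpa using hπ.mean_shortCount_one_le hlam hk hm0 hm
  | succ i ih =>
    refine (hπ.mean_shortCount_succ_le hlam hm0 hm i.succ_pos).trans ?_
    rw [pow_succ', mul_assoc, ENNReal.ofReal_mul (by positivity)]
    gcongr
    exact mul_le_of_le_one_left (by positivity) hlam1

end IsStationary

section Deficit

variable {N : ℕ}

theorem frac_eq_one_sub (hN : 0 < N) (s : State N) (i : ℕ) : frac s i = 1 - shortCount i s / N := by
  have : (0 : ℝ) < N := by exact_mod_cast hN
  rw [frac, countP_le_eq_card_sub_shortCount, Sym.card_coe]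
  field_simp

theorem natCast_sub_sum_frac (hN : 0 < N) (s : State N) (h : ℕ) :
    h - ∑ i ∈ Finset.Icc 1 h, frac s i =
      1 / N * ∑ i ∈ Finset.range h, shortCount (i + 1) s := by
  induction h with
  | zero => simp
  | succ h ih =>
    rw [Finset.sum_Icc_succ_top (Nat.le_add_left 1 h), Finset.sum_range_succ, mul_add, ← ih,
      frac_eq_one_sub hN]
    push_cast
    ring

theorem sum_pow_one_add_le {d : ℝ} (hd : 0 < d) (n : ℕ) :
    ∑ i ∈ Finset.range n, (1 + d) ^ i ≤ (1 + d) ^ n / d := by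
  rw [geom_sum_eq (by linarith), add_sub_cancel_left]
  gcongr
  linarith

variable {lam : ℝ} {k m : ℕ} {π : PMF (State N)}

theorem IsStationary.mean_natCast_sub_sum_frac_le (hπ : IsStationary lam k m π) (hlam : 0 ≤ lam)
    (hlam1 : lam ≤ 1) (hk : 0 < k) (hm0 : 0 < m) (hm : m ≤ N) (h : ℕ) :
    mean π (fun s => .ofReal (h - ∑ i ∈ Finset.Icc 1 h, frac s i)) ≤
      .ofReal ((1 - lam) * ((1 + m / k) ^ h / (m / k))) := by
  have hN : 0 < N := hm0.trans_le hm
  have hterm : ∀ i, 0 ≤ (1 + m / k : ℝ) ^ i * (N * (1 - lam)) := fun i =>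
    mul_nonneg (by positivity) (mul_nonneg (by positivity) (sub_nonneg.2 hlam1))
  have hsum : ∀ s : State N, ENNReal.ofReal (h - ∑ i ∈ Finset.Icc 1 h, frac s i) =
      .ofReal (1 / N) * ∑ i ∈ Finset.range h, .ofReal (shortCount (i + 1) s) := by
    intro s
    rw [natCast_sub_sum_frac hN, ENNReal.ofReal_mul (by positivity),
      ENNReal.ofReal_sum_of_nonneg fun i _ => shortCount_nonneg (i + 1) s]
  simp only [hsum]
  rw [mean_const_mul, mean_finsetSum]
  calc _ ≤ ENNReal.ofReal (1 / N) *
        ∑ i ∈ Finset.range h, .ofReal ((1 + m / k) ^ i * (N * (1 - lam))) := by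
        gcongr with i
        exact hπ.mean_shortCount_le hlam hlam1 hk hm0 hm i
    _ = .ofReal ((1 - lam) * ∑ i ∈ Finset.range h, (1 + m / k : ℝ) ^ i) := by
        have : (0 : ℝ) < N := by exact_mod_cast hN
        rw [← ENNReal.ofReal_sum_of_nonneg fun i _ => hterm i, ← ENNReal.ofReal_mul (by positivity),
          ← Finset.sum_mul]
        congr 1
        field_simp
    _ ≤ _ := by
        refine ENNReal.ofReal_le_ofReal (mul_le_mul_of_nonneg_left ?_ (sub_nonneg.2 hlam1))
        exact sum_pow_one_add_le (by positivity) h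

theorem IsStationary.ofReal_one_sub_le_toOuterMeasure (hπ : IsStationary lam k m π)
    (hlam : 0 ≤ lam) (hlam1 : lam ≤ 1) (hk : 0 < k) (hm0 : 0 < m) (hm : m ≤ N) (h : ℕ) {δ : ℝ}
    (hδ : 0 < δ) :
    .ofReal (1 - (1 - lam) * ((1 + m / k) ^ h / (m / k)) / δ) ≤
      π.toOuterMeasure {s | h - δ ≤ ∑ i ∈ Finset.Icc 1 h, frac s i} := by
  have hmarkov := one_le_toOuterMeasure_add_mean π
    (fun s : State N => h - ∑ i ∈ Finset.Icc 1 h, frac s i) hδ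
  simp only [sub_le_comm (b := Finset.sum _ _)] at hmarkov
  have hnonneg : 0 ≤ (1 - lam) * ((1 + m / k : ℝ) ^ h / (m / k)) / δ :=
    div_nonneg (mul_nonneg (sub_nonneg.2 hlam1) (by positivity)) hδ.le
  rw [ENNReal.ofReal_sub _ hnonneg, ENNReal.ofReal_one, tsub_le_iff_right,
    ENNReal.ofReal_div_of_pos hδ]
  refine hmarkov.trans ?_
  gcongr
  exact hπ.mean_natCast_sub_sum_frac_le hlam hlam1 hk hm0 hm h

end Deficit

section ExistenceUniqueness

variable {N : ℕ} {lam : ℝ} {k m : ℕ}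

theorem finite_setOf_queueSum_le (N : ℕ) (B : ℝ) :
    {s : State N | queueSum Nat.cast s ≤ B}.Finite := by
  refine ((Finset.range (⌊B⌋₊ + 1)).sym N).finite_toSet.subset fun s hs => ?_
  simp only [Finset.mem_coe, Finset.mem_sym_iff, Finset.mem_range]
  intro x hx
  exact Nat.lt_succ_of_le (Nat.le_floor
    ((le_queueSum_of_mem (φ := Nat.cast) Nat.cast_nonneg (t := s) hx).trans hs))

theorem jumpRate_afterDeparture_ne_zero (hlam : 0 ≤ lam) {s s' : State N} {x : ℕ} (hx : x ∈ s)
    (hx0 : 0 < x) (hs' : afterDeparture s x = s') : jumpRate lam k m s s' ≠ 0 := by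
  have hdep : 0 < departureRate s s' :=
    Nat.cast_pos.2 (Multiset.countP_pos.2 ⟨x, hx, hx0, hs'⟩)
  have harr : 0 ≤ arrivalRate lam k m s s' := by
    unfold arrivalRate
    positivity
  exact (ENNReal.ofReal_pos.2 (add_pos_of_nonneg_of_pos harr hdep)).ne'

theorem exists_of_jumpRate_ne_zero {s s' : State N} (h : jumpRate lam k m s s' ≠ 0) :
    (∃ a ≤ (s : Multiset ℕ), a.card = m ∧ afterArrival k s a = s') ∨
      ∃ x ∈ (s : Multiset ℕ), afterDeparture s x = s' := by
  by_contra! hnot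
  refine h ?_
  have hsample : ((s : Multiset ℕ).powersetCard m).countP
      (fun a => (s : Multiset ℕ) - a + fill k a = s') = 0 :=
    Multiset.countP_eq_zero.2 fun a ha =>
      hnot.1 a (Multiset.mem_powersetCard.1 ha).1 (Multiset.mem_powersetCard.1 ha).2
  have harr : arrivalRate lam k m s s' = 0 := by
    rw [arrivalRate, hsample, Nat.cast_zero, zero_div, mul_zero]
  have hdep : departureRate s s' = 0 :=
    Nat.cast_eq_zero.2 (Multiset.countP_eq_zero.2 fun x hx hs' => hnot.2 x hx hs'.2)
  rw [jumpRate, rate, harr, hdep, add_zero, ENNReal.ofReal_zero]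

theorem finite_setOf_jumpRate_ne_zero (lam : ℝ) (k : ℕ) (hm0 : 0 < m) (s' : State N) :
    {s : State N | jumpRate lam k m s s' ≠ 0}.Finite := by
  refine (finite_setOf_queueSum_le N (queueSum Nat.cast s' + 1)).subset fun s hs => ?_
  rw [Set.mem_ofPred_eq]
  rcases exists_of_jumpRate_ne_zero hs with ⟨a, ha, ham, hs'⟩ | ⟨x, hx, hs'⟩
  · rw [← hs', queueSum_afterArrival _ k ha,
      queueSum_natCast_fill k (Multiset.card_pos.1 (ham ▸ hm0))]
    linarith [(Nat.cast_nonneg k : (0 : ℝ) ≤ k)]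
  · rw [← hs', queueSum_afterDeparture _ hx]
    have hle : x ≤ x - 1 + 1 := by omega
    have hle' : (x : ℝ) ≤ (x - 1 : ℕ) + 1 := by exact_mod_cast hle
    linarith

theorem reflTransGen_jumpRate_replicate_zero (hlam : 0 ≤ lam) (s : State N) :
    Relation.ReflTransGen (fun s s' : State N => jumpRate lam k m s s' ≠ 0) s
      (Sym.replicate N 0) := by
  induction hn : (s : Multiset ℕ).sum using Nat.strong_induction_on generalizing s with
  | _ n ih =>
    by_cases hempty : ∀ x ∈ s, x = 0
    · rw [Sym.eq_replicate.2 hempty]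
    push Not at hempty
    obtain ⟨x, hx, hx0⟩ := hempty
    let s' : State N := ⟨afterDeparture s x, (card_afterDeparture hx).trans s.2⟩
    have hsum : (s' : Multiset ℕ).sum < n := by
      have hs := congrArg Multiset.sum (Multiset.cons_erase (show x ∈ (s : Multiset ℕ) from hx))
      change ((x - 1) ::ₘ (s : Multiset ℕ).erase x).sum < n
      rw [Multiset.sum_cons] at hs ⊢
      omega
    exact .head (jumpRate_afterDeparture_ne_zero hlam hx (Nat.pos_of_ne_zero hx0) rfl)
      (ih _ hsum s' rfl)

theorem tsum_jumpRate_mul_queueSum_sq_add_le (s : State N) (hlam : 0 ≤ lam) (hlam1 : lam ≤ 1)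
    (hk : 0 < k) (hm0 : 0 < m) (hm : m ≤ N) :
    ∑' s', jumpRate lam k m s s' * .ofReal (queueSum (fun x => (x : ℝ) ^ 2) s') +
        .ofReal (2 * (1 - lam) * queueSum Nat.cast s) ≤
      (∑' s', jumpRate lam k m s s') * .ofReal (queueSum (fun x => (x : ℝ) ^ 2) s) +
        .ofReal (N * (lam * k + 1)) := by
  refine tsum_jumpRate_mul_add_le s hlam hm (f := queueSum fun x => (x : ℝ) ^ 2)
    (fun t => queueSum_nonneg fun x => sq_nonneg (x : ℝ))
    (mul_nonneg (by linarith) (queueSum_nonneg Nat.cast_nonneg)) (by positivity) ?_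
  have hdrift := generator_queueSum_sq_le hlam hk hm0 (hm.trans_eq (Sym.card_coe (s := s)).symm)
  rw [Sym.card_coe] at hdrift
  linarith

theorem existsUnique_isStationary (hlam : 0 ≤ lam) (hlam1 : lam < 1) (hk : 0 < k) (hm0 : 0 < m)
    (hm : m ≤ N) : ∃! π : PMF (State N), IsStationary lam k m π := by
  have hN : (0 : ℝ) < N := by exact_mod_cast hm0.trans_le hm
  have hL : (.ofReal (N * lam / k + N) : ℝ≥0∞) ≠ 0 := (ENNReal.ofReal_pos.2 (by positivity)).ne'
  have hq : ∀ s : State N, ∑' s', jumpRate lam k m s s' ≤ .ofReal (N * lam / k + N) :=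
    fun s => tsum_jumpRate_le s hlam hm
  have hgap : 0 < 2 * (1 - lam) := by linarith
  have hfin : ∀ n : ℕ, {s : State N |
      ENNReal.ofReal (2 * (1 - lam) * queueSum Nat.cast s) ≤ n}.Finite := by
    refine fun n => (finite_setOf_queueSum_le N (n / (2 * (1 - lam)))).subset fun s hs => ?_
    rw [Set.mem_ofPred_eq, ENNReal.ofReal_le_natCast] at hs
    exact (le_div_iff₀' hgap).2 hs
  obtain ⟨π, hπ⟩ := exists_balanced_of_drift (x₀ := Sym.replicate N 0) (jumpRate lam k m) hL
    ENNReal.ofReal_ne_top hq (finite_setOf_jumpRate_ne_zero lam k hm0) ENNReal.ofReal_ne_top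
    ENNReal.ofReal_ne_top hfin fun s =>
      tsum_jumpRate_mul_queueSum_sq_add_le s hlam hlam1.le hk hm0 hm
  exact ⟨π, hπ, fun π' hπ' => Balanced.pmf_unique hπ' hπ ENNReal.ofReal_ne_top hq _
    (reflTransGen_jumpRate_replicate_zero hlam)⟩

end ExistenceUniqueness

section Subpolynomial

variable {ι : Type*} {l : Filter ι}

theorem isLittleO_mul_of_isLittleO_div {f g u : ι → ℝ} (h : f =o[l] fun x => g x / u x) :
    (fun x => u x * f x) =o[l] g := by
  refine ((isBigO_refl u l).mul_isLittleO h).trans_isBigO (.of_bound' (.of_forall fun x => ?_))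
  rcases eq_or_ne (u x) 0 with hu | hu
  · simp [hu]
  · rw [mul_div_cancel₀ _ hu]

theorem isLittleO_of_isLittleO_div {f g u : ι → ℝ} {b : ℝ} (hb : 0 < b) (hu : ∀ᶠ x in l, b ≤ u x)
    (h : f =o[l] fun x => g x / u x) : f =o[l] g := by
  refine IsBigO.trans_isLittleO (.of_bound b⁻¹ ?_) (isLittleO_mul_of_isLittleO_div h)
  filter_upwards [hu] with x hx
  rw [norm_mul, Real.norm_of_nonneg (hb.le.trans hx)]
  calc ‖f x‖ = b⁻¹ * (b * ‖f x‖) := (inv_mul_cancel_left₀ hb.ne' _).symm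
    _ ≤ b⁻¹ * (u x * ‖f x‖) := by gcongr

theorem log_one_add_le {x : ℝ} (hx : 0 < x) : Real.log (1 + x) ≤ 1 + |Real.log x| := by
  have hlog2 : Real.log 2 ≤ 1 := by linarith [Real.log_le_sub_one_of_pos two_pos]
  rcases le_total x 1 with hx1 | hx1
  · have hlog : Real.log (1 + x) ≤ Real.log 2 := Real.log_le_log (by linarith) (by linarith)
    linarith [abs_nonneg (Real.log x)]
  · have hlog : Real.log (1 + x) ≤ Real.log 2 + Real.log x := by
      rw [← Real.log_mul two_ne_zero hx.ne']
      exact Real.log_le_log (by linarith) (by linarith)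
    linarith [le_abs_self (Real.log x)]

theorem log_one_add_pow_isLittleO {d g u : ι → ℝ} {h : ι → ℕ} (hd_pos : ∀ᶠ x in l, 0 < d x)
    (hu : u =o[l] g) (hd : (fun x => Real.log (d x)) =o[l] fun x => g x / u x)
    (hh : (fun x => (h x : ℝ)) =O[l] u) :
    (fun x => Real.log ((1 + d x) ^ h x)) =o[l] g := by
  have hud : (fun x => u x * (1 + |Real.log (d x)|)) =o[l] g := by
    simp only [mul_add, mul_one]
    exact hu.add (isLittleO_mul_of_isLittleO_div hd.abs_left)
  have hlog : (fun x => Real.log (1 + d x)) =O[l] fun x => 1 + |Real.log (d x)| := by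
    refine .of_bound' ?_
    filter_upwards [hd_pos] with x hx
    rw [Real.norm_of_nonneg (Real.log_nonneg (by linarith))]
    exact (log_one_add_le hx).trans (le_abs_self _)
  simp only [Real.log_pow]
  exact (hh.mul hlog).trans_isLittleO hud

variable {f : ℕ → ℝ}

theorem eventually_le_rpow_of_log_isLittleO (hf_pos : ∀ᶠ N in atTop, 0 < f N)
    (hf : (fun N => Real.log (f N)) =o[atTop] fun N : ℕ => Real.log N) {ε : ℝ} (hε : 0 < ε) :
    ∀ᶠ N : ℕ in atTop, f N ≤ (N : ℝ) ^ ε := by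
  filter_upwards [hf.bound hε, hf_pos, eventually_ge_atTop 1] with N hN hfN hN1
  have hN0 : (0 : ℝ) < N := by exact_mod_cast hN1
  rw [Real.norm_of_nonneg (Real.log_natCast_nonneg N)] at hN
  rw [← Real.log_le_log_iff hfN (by positivity), Real.log_rpow hN0]
  exact (le_abs_self _).trans hN

theorem tendsto_rpow_neg_mul_of_log_isLittleO (hf_pos : ∀ᶠ N in atTop, 0 < f N)
    (hf : (fun N => Real.log (f N)) =o[atTop] fun N : ℕ => Real.log N) {α : ℝ} (hα : 0 < α) :
    Tendsto (fun N : ℕ => (N : ℝ) ^ (-α) * f N) atTop (𝓝 0) := by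
  have hlim : Tendsto (fun N : ℕ => (N : ℝ) ^ (-(α / 2))) atTop (𝓝 0) :=
    (tendsto_rpow_neg_atTop (half_pos hα)).comp tendsto_natCast_atTop_atTop
  refine squeeze_zero' ?_ ?_ hlim
  · filter_upwards [hf_pos] with N hfN
    positivity
  · filter_upwards [eventually_le_rpow_of_log_isLittleO hf_pos hf (half_pos hα),
      eventually_ge_atTop 1] with N hfN hN1
    have hN0 : (0 : ℝ) < N := by exact_mod_cast hN1
    calc (N : ℝ) ^ (-α) * f N ≤ (N : ℝ) ^ (-α) * (N : ℝ) ^ (α / 2) := by gcongr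
      _ = (N : ℝ) ^ (-(α / 2)) := by rw [← Real.rpow_add hN0]; ring_nf

theorem log_isLittleO_log_of_isLittleO_sqrt_log {k : ℕ → ℕ}
    (hk : (fun N : ℕ => Real.log (k N)) =o[atTop] fun N : ℕ => Real.sqrt (Real.log N)) :
    (fun N : ℕ => Real.log (k N)) =o[atTop] fun N : ℕ => Real.log N := by
  refine hk.trans_isBigO (.of_bound' ?_)
  have hlog : Tendsto (fun N : ℕ => Real.log N) atTop atTop :=
    Real.tendsto_log_atTop.comp tendsto_natCast_atTop_atTop
  filter_upwards [hlog.eventually_ge_atTop 1] with N hN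
  rw [Real.norm_of_nonneg (Real.sqrt_nonneg _), Real.norm_of_nonneg (zero_le_one.trans hN)]
  exact Real.sqrt_le_self_iff.2 (.inr hN)

theorem eventually_le_of_log_isLittleO {k m : ℕ → ℕ} {d : ℕ → ℝ} (hk2 : ∀ᶠ N in atTop, 2 ≤ k N)
    (hk : (fun N : ℕ => Real.log (k N)) =o[atTop] fun N : ℕ => Real.log N)
    (hd_pos : ∀ᶠ N in atTop, 0 < d N) (hm : ∀ᶠ N in atTop, (m N : ℝ) = k N * d N)
    (hd : (fun N : ℕ => Real.log (d N)) =o[atTop] fun N : ℕ => Real.log N / Real.log (k N)) :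
    ∀ᶠ N in atTop, m N ≤ N := by
  have hlogk : ∀ᶠ N in atTop, Real.log 2 ≤ Real.log (k N) := by
    filter_upwards [hk2] with N hkN
    exact Real.log_le_log two_pos (by exact_mod_cast hkN)
  have hpos : ∀ᶠ N in atTop, 0 < k N * d N := by
    filter_upwards [hk2, hd_pos] with N hkN hdN
    positivity
  have hlog : (fun N : ℕ => Real.log (k N * d N)) =o[atTop] fun N : ℕ => Real.log N := by
    refine (hk.add (isLittleO_of_isLittleO_div (Real.log_pos one_lt_two) hlogk hd)).congr' ?_ .rfl
    filter_upwards [hk2, hd_pos] with N hkN hdN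
    rw [Real.log_mul (by positivity) hdN.ne']
  filter_upwards [hm, eventually_le_rpow_of_log_isLittleO hpos hlog one_pos] with N hmN hN
  rw [← hmN, Real.rpow_one] at hN
  exact_mod_cast hN

end Subpolynomial

end BatchFilling

open BatchFilling in
theorem theorem3_general {α β A c : ℝ} (hα0 : 0 < α) (hβ0 : 0 < β) (hA : 0 < A) (hc : c < 1)
    {k m h : ℕ → ℕ} {d : ℕ → ℝ} (hk2 : ∀ᶠ N in atTop, 2 ≤ k N)
    (hk : (fun N : ℕ => Real.log (k N)) =o[atTop] fun N : ℕ => Real.log N)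
    (hd_pos : ∀ᶠ N in atTop, 0 < d N) (hm : ∀ᶠ N in atTop, (m N : ℝ) = k N * d N)
    (hd : (fun N : ℕ => Real.log (d N)) =o[atTop] fun N : ℕ => Real.log N / Real.log (k N))
    (hh : (fun N : ℕ => (h N : ℝ)) =O[atTop] fun N : ℕ => Real.log (k N)) :
    ∀ᶠ N : ℕ in atTop,
      (∃! π : PMF (State N), IsStationary (1 - β * (N : ℝ) ^ (-α)) (k N) (m N) π) ∧
      ∀ π : PMF (State N), IsStationary (1 - β * (N : ℝ) ^ (-α)) (k N) (m N) π →
        ENNReal.ofReal c ≤ π.toOuterMeasure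
          {s | (h N : ℝ) - 1 / (A * d N) ≤ ∑ i ∈ Finset.Icc 1 (h N), frac s i} := by
  have hpow_pos : ∀ᶠ N in atTop, 0 < (1 + d N) ^ h N := by
    filter_upwards [hd_pos] with N hdN
    positivity
  have hloss : Tendsto (fun N : ℕ => A * β * ((N : ℝ) ^ (-α) * (1 + d N) ^ h N)) atTop (𝓝 0) := by
    simpa only [mul_zero] using (tendsto_rpow_neg_mul_of_log_isLittleO hpow_pos
      (log_one_add_pow_isLittleO hd_pos hk hd hh) hα0).const_mul (A * β)
  have hload : Tendsto (fun N : ℕ => β * (N : ℝ) ^ (-α)) atTop (𝓝 0) := by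
    simpa only [mul_zero, Function.comp_def] using
      ((tendsto_rpow_neg_atTop hα0).comp tendsto_natCast_atTop_atTop).const_mul β
  filter_upwards [hk2, hd_pos, hm, eventually_le_of_log_isLittleO hk2 hk hd_pos hm hd,
    hloss.eventually_le_const (sub_pos.2 hc), hload.eventually_le_const one_pos,
    eventually_gt_atTop 0] with N hkN hdN hmN hmle hlossN hloadN hN
  have hk0 : (0 : ℝ) < k N := by positivity
  have hm0 : 0 < m N := by rw [← Nat.cast_pos (α := ℝ), hmN]; positivity
  have hload0 : 0 < β * (N : ℝ) ^ (-α) := by positivity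
  have hratio : (m N / k N : ℝ) = d N := by rw [hmN, mul_div_cancel_left₀ _ hk0.ne']
  refine ⟨existsUnique_isStationary (by linarith) (by linarith) (by omega) hm0 hmle,
    fun π hπ => le_trans (ENNReal.ofReal_le_ofReal ?_) (hπ.ofReal_one_sub_le_toOuterMeasure
      (by linarith) (by linarith) (by omega) hm0 hmle (h N) (δ := 1 / (A * d N)) (by positivity))⟩
  have hbound : (1 - (1 - β * (N : ℝ) ^ (-α))) * ((1 + m N / k N) ^ h N / (m N / k N)) /
      (1 / (A * d N)) = A * β * ((N : ℝ) ^ (-α) * (1 + d N) ^ h N) := by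
    rw [hratio]
    field_simp
    ring
  linarith

theorem theorem3 (α β : ℝ) (hα0 : 0 < α) (hα : α < 1 / 2) (hβ0 : 0 < β) (hβ : β ≤ 1)
    (k m h : ℕ → ℕ) (d : ℕ → ℝ)
    (hk_top : Tendsto k atTop atTop)
    (hk : (fun N : ℕ => Real.log (k N)) =o[atTop] fun N : ℕ => Real.sqrt (Real.log N))
    (hd_pos : ∀ᶠ N : ℕ in atTop, 0 < d N)
    (hm : ∀ᶠ N : ℕ in atTop, (m N : ℝ) = k N * d N)
    (hd : (fun N : ℕ => Real.log (d N)) =o[atTop]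
      fun N : ℕ => Real.log N / Real.log (k N))
    (hh : (fun N : ℕ => (h N : ℝ)) =O[atTop] fun N : ℕ => Real.log (k N)) :
    ∀ᶠ N : ℕ in atTop,
      (∃! π : PMF (BatchFilling.State N),
        BatchFilling.IsStationary (1 - β * (N : ℝ) ^ (-α)) (k N) (m N) π) ∧
      ∀ π : PMF (BatchFilling.State N),
        BatchFilling.IsStationary (1 - β * (N : ℝ) ^ (-α)) (k N) (m N) π →
        ENNReal.ofReal (1 / (4 * Real.exp 1 ^ 2)) ≤
          π.toOuterMeasure {s : BatchFilling.State N |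
            (h N : ℝ) - 1 / (3 * d N) ≤ ∑ i ∈ Finset.Icc 1 (h N), BatchFilling.frac s i} := by
  have hexp : (1 : ℝ) ≤ Real.exp 1 := Real.one_le_exp zero_le_one
  have hc : 1 / (4 * Real.exp 1 ^ 2) < 1 := by
    rw [div_lt_one (by positivity)]
    linarith [one_le_pow₀ hexp (n := 2)]
  exact theorem3_general hα0 hβ0 three_pos hc (hk_top.eventually_ge_atTop 2)
    (BatchFilling.log_isLittleO_log_of_isLittleO_sqrt_log hk) hd_pos hm hd hh
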